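/- Let $n\ge 1$, $0\le k\le n$, $s=\min(k,n-k)$, let $X$ be the set of $k$-subsets of $\{1,\dots,n\}$ and let $\mathcal F$ be the space of functions $X\to\mathbb C$, with the inner product for which the delta functions $\delta(x)$, $x\in X$, are orthonormal, and with the action $\sigma f=f\circ\sigma^{-1}$ of $S_n$. For $j\le n$ let $S_j\subseteq S_n$ be the subgroup that fixes $j+1,\dots,n$, and for a Young diagram $\lambda$ with $j$ boxes let $\mathcal F_{j,\lambda}$ be the isotypic component of $\mathcal F$, as an $S_j$-module, for the irreducible representation $V_\lambda$ of $S_j$. For a set $w\subseteq\{i+1,\dots,n\}$ let $\mathcal F^w$ be the span of the $\delta(x)$ with $x\cap\{i+1,\dots,n\}=w$. Let $B_0=B_1$ be the basis of delta functions, and for $2\le i\le n$ let $B_i$ be an orthonormal basis of $\mathcal F$ each of whose elements lies in a space $\mathcal F_{1,\lambda_1}\cap\dots\cap\mathcal F_{i,\lambda_i}\cap\mathcal F^{w}$ for some path $\lambda_1\nearrow\dots\nearrow\lambda_i$ in the Young graph starting at the one-box diagram and some $w\subseteq\{i+1,\dots,n\}$ (these spaces have dimension at most one, so $B_i$ is determined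 up to order and scalars of modulus one; $B_n$ is a Gelfand–Tsetlin basis of $\mathcal F$). Let $[B_{i-1}]_{B_i}$ be the change of basis matrix, so that $[f]_{B_i}=[B_{i-1}]_{B_i}[f]_{B_{i-1}}$. For $0\le a\le s$ let $\mathcal F_a=\mathcal F_{n,(n-a,a)}$; then $\mathcal F=\bigoplus_{a=0}^s\mathcal F_a$ orthogonally. For $f\in\mathcal F$ write $f=\sum_{a=0}^s f_a$ with $f_a\in\mathcal F_a$, and for $H\subseteq\{0,\dots,s\}$ put $f_H=\sum_{a\in H}f_a$. **Theorem.** Assume that the matrices $[B_{i-1}]_{B_i}$, $i=2,\dots,n$, are known. Then for every $H\subseteq\{0,\dots,s\}$ the column vector $[f_H]_{B_0}$ can be computed from the column vector $[f]_{B_0}$, $f\in\mathcal F$, with at most $4(n-1)\binom nk$ operations. That is, there is an arithmetic circuit, independent of $f$, with at most $4(n-1)\binom nk$ operations $(u,v,w)\mapsto uv+w$ (a complex multiplication and addition counts as one operation), whose only constants are $0$, $1$ and the entries of the unitary matrices $[B_{i-1}]_{B_i}$ and of their inverses $[B_i]_{B_{i-1}}$, $2\le i\le n$, that maps $[f]_{B_0}$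 to $[f_H]_{B_0}$ for every $f\in\mathcal F$. -/

import Mathlib

noncomputable section

namespace Johnson

open Equiv

/-! ### Functions on the Johnson graph -/

/-- The set `X` of `k`-subsets of an `n`-set; the places `1, …, n` are `0, …, n - 1` in `Fin n`. -/
abbrev X (n k : ℕ) : Type := Set.powersetCard (Fin n) k

/-- The complex functions on `X`, with the inner product that makes the delta functions
orthonormal. -/
abbrev F (n k : ℕ) : Type := EuclideanSpace ℂ (X n k)

/-- The orthonormal basis of delta functions. -/
def deltaBasis (n k : ℕ) : OrthonormalBasis (X n k) ℂ (F n k) :=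
  EuclideanSpace.basisFun (X n k) ℂ

/-- The representation of `S_n` on `F n k`, given by `σ f = f ∘ σ⁻¹`. -/
def rep (n k : ℕ) : Representation ℂ (Perm (Fin n)) (F n k) where
  toFun σ :=
    { toFun := fun f => WithLp.toLp 2 fun x => f (σ⁻¹ • x)
      map_add' := fun _ _ => rfl
      map_smul' := fun _ _ => rfl }
  map_one' := by
    ext f x
    simp
  map_mul' σ τ := by
    ext f x
    change f ((σ * τ)⁻¹ • x) = f (τ⁻¹ • σ⁻¹ • x)
    rw [mul_inv_rev, mul_smul]

/-- `F n k` as a representation of `S_j`, which permutes the first `j` places and fixes the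
last `n - j` ones. -/
def repRestrict (n k : ℕ) {j : ℕ} (hj : j ≤ n) : Representation ℂ (Perm (Fin j)) (F n k) :=
  (rep n k).comp (Perm.viaEmbeddingHom (Fin.castLEEmb hj))

/-! ### The irreducible representations of the symmetric group -/

/-- A Young tableau of shape `μ` (a bijective filling, not necessarily standard):
`t p` is the box `(row, column)` that holds `p`. -/
abbrev Tableau (j : ℕ) (μ : YoungDiagram) : Type := Fin j ≃ μ.cells

open Classical in
/-- The Young symmetrizer of `t`: the sum of the permutations that preserve the rows of `t` times
the signed sum of the permutations that preserve the columns of `t`. -/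
def youngSymmetrizer {j : ℕ} {μ : YoungDiagram} (t : Tableau j μ) :
    MonoidAlgebra ℂ (Perm (Fin j)) :=
  (∑ σ : Perm (Fin j) with ∀ p, (t (σ p)).1.1 = (t p).1.1, MonoidAlgebra.single σ 1) *
    (∑ τ : Perm (Fin j) with ∀ p, (t (τ p)).1.2 = (t p).1.2,
      MonoidAlgebra.single τ ((Perm.sign τ : ℤ) : ℂ))

/-- The irreducible representation `V_μ` of `S_j` attached to the Young diagram `μ` with `j` boxes,
as the left ideal of the group algebra generated by the Young symmetrizer of a tableau `t` of
shape `μ`. Its isomorphism class does not depend on `t`. -/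
def specht {j : ℕ} {μ : YoungDiagram} (t : Tableau j μ) :
    Ideal (MonoidAlgebra ℂ (Perm (Fin j))) :=
  Ideal.span {youngSymmetrizer t}

/-- The isotypic component `F_{j,μ}` of `F n k`, as an `S_j`-module, for the irreducible
representation `V_μ`. All tableaux `t` of shape `μ` give the same component; the supremum only
avoids to choose one. -/
def isotypic (n k : ℕ) {j : ℕ} (hj : j ≤ n) (μ : YoungDiagram) : Submodule ℂ (F n k) :=
  ⨆ t : Tableau j μ,
    ((isotypicComponent (MonoidAlgebra ℂ (Perm (Fin j))) (repRestrict n k hj).asModule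
      (specht t)).restrictScalars ℂ).map (repRestrict n k hj).asModuleEquiv.toLinearMap

/-! ### The intermediate bases -/

/-- `l 1 ↗ l 2 ↗ ⋯ ↗ l i` is a path in the Young graph that starts at the one-box diagram,
that is, a standard Young tableau with `i` boxes. -/
def IsYoungChain (i : ℕ) (l : ℕ → YoungDiagram) : Prop :=
  (∀ j, 1 ≤ j → j ≤ i → (l j).card = j) ∧ ∀ j, 1 ≤ j → j < i → l j ≤ l (j + 1)

/-- The space `F^w` spanned by the delta functions of the `k`-sets `x` whose word ends in `w`.
The word `w`, on the last `n - i` places, is given by the places that carry the letter `1`;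
what `w` says about the first `i` places is ignored. -/
def suffixSpace (n k i : ℕ) (w : Set (Fin n)) : Submodule ℂ (F n k) :=
  Submodule.span ℂ (deltaBasis n k '' {x | ∀ p : Fin n, i ≤ p.val → (p ∈ x.1 ↔ p ∈ w)})

/-- The Gelfand–Tsetlin space
`F^w_{l 1 ↗ ⋯ ↗ l i} = F_{1, l 1} ∩ ⋯ ∩ F_{i, l i} ∩ F^w`. -/
def gtSpace (n k : ℕ) {i : ℕ} (hi : i ≤ n) (l : ℕ → YoungDiagram) (w : Set (Fin n)) :
    Submodule ℂ (F n k) :=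
  (⨅ (j : ℕ) (_ : 1 ≤ j) (hj : j ≤ i), isotypic n k (hj.trans hi) (l j)) ⊓ suffixSpace n k i w

/-- `B 0, B 1, …, B n` are the bases `B_0, …, B_n`: `B 0` is the delta basis, and for
`1 ≤ i ≤ n` every element of the orthonormal basis `B i` lies in one of the Gelfand–Tsetlin
spaces of level `i`. These are pairwise orthogonal lines (or zero), so this determines `B i` up
to order and scalars of modulus one. For `i = 1` the lines are those of the delta
functions, and `B 1` is normalized to be the delta basis itself. `X n k` serves as the index
set of all of these bases. -/
structure IsIntermediateBases {n k : ℕ}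
    (B : ℕ → OrthonormalBasis (X n k) ℂ (F n k)) : Prop where
  zero : B 0 = deltaBasis n k
  one : B 1 = deltaBasis n k
  gelfandTsetlin : ∀ (i : ℕ) (_ : 1 ≤ i) (hi : i ≤ n) (x : X n k),
    ∃ (l : ℕ → YoungDiagram) (w : Set (Fin n)), IsYoungChain i l ∧ B i x ∈ gtSpace n k hi l w

/-- The change of basis matrix `[B]_{B'}`, so that `[f]_{B'} = [B]_{B'} [f]_B`. -/
def changeOfBasis {n k : ℕ} (B B' : OrthonormalBasis (X n k) ℂ (F n k)) :
    Matrix (X n k) (X n k) ℂ :=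
  B'.toBasis.toMatrix B

/-! ### The isotypic components of a function -/

/-- The Young diagram `(p, q)`. -/
def twoRow (p q : ℕ) (h : q ≤ p) : YoungDiagram :=
  YoungDiagram.ofRowLens [p, q] (by simp [List.sortedGE_iff_pairwise, h])

/-- The isotypic component `F_a` of `F n k` for the Young diagram `(n - a, a)`, where
`0 ≤ a ≤ s = min k (n - k)`. -/
def component (n k : ℕ) (a : Fin (min k (n - k) + 1)) : Submodule ℂ (F n k) :=
  isotypic n k le_rfl (twoRow (n - a) a (by have := a.2; omega))

/-- `f_H`, the sum over `a ∈ H` of the components `f_a` of `f` in the orthogonal decomposition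
`F = F_0 ⊕ ⋯ ⊕ F_s`. -/
def part {n k : ℕ} (H : Finset (Fin (min k (n - k) + 1))) (f : F n k) : F n k :=
  ∑ a ∈ H, (component n k a).starProjection f

/-! ### Arithmetic circuits -/

/-- What an instruction can read: an input coordinate, a constant, or the result of the
instruction number `j` (counted from `0`). -/
inductive Operand (ι : Type)
  | input (x : ι)
  | const (c : ℂ)
  | result (j : ℕ)

/-- The value of an operand on the input `v` when `mem` lists the results computed so far.
(A reference to a result not computed yet reads `0`.) -/
def Operand.eval {ι : Type} (v : ι → ℂ) (mem : List ℂ) : Operand ι → ℂ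
  | .input x => v x
  | .const c => c
  | .result j => mem.getD j 0

/-- One operation: a multiplication and an addition, `a * b + c`. -/
structure Instruction (ι : Type) where
  a : Operand ι
  b : Operand ι
  c : Operand ι

/-- An arithmetic circuit, as a straight-line program: a list of operations, and an operand for
every coordinate of the output. -/
structure Circuit (ι κ : Type) where
  instructions : List (Instruction ι)
  output : κ → Operand ι

namespace Circuit

variable {ι κ : Type}

/-- The results of the instructions, in order. -/
def results (P : Circuit ι κ) (v : ι → ℂ) : List ℂ :=
  P.instructions.foldl
    (fun mem I => mem ++ [I.a.eval v mem * I.b.eval v mem + I.c.eval v mem]) []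

/-- The output of the circuit on the input `v`. -/
def eval (P : Circuit ι κ) (v : ι → ℂ) : κ → ℂ :=
  fun y => (P.output y).eval v (P.results v)

/-- The number of operations. -/
def cost (P : Circuit ι κ) : ℕ := P.instructions.length

/-- All constants that occur in the circuit belong to `K`. -/
def ConstantsIn (P : Circuit ι κ) (K : Set ℂ) : Prop :=
  (∀ I ∈ P.instructions, ∀ c : ℂ,
    I.a = .const c ∨ I.b = .const c ∨ I.c = .const c → c ∈ K) ∧
  ∀ (y : κ) (c : ℂ), P.output y = .const c → c ∈ K

end Circuit

/-- The constants available once the matrices `[B_{i-1}]_{B_i}`, `2 ≤ i ≤ n`, are known: `0`, `1`,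
the entries of these unitary matrices, and those of their inverses `[B_i]_{B_{i-1}}`, which are
their conjugate transposes. -/
def knownConstants {n k : ℕ} (B : ℕ → OrthonormalBasis (X n k) ℂ (F n k)) : Set ℂ :=
  {0, 1} ∪ {c | ∃ i, 2 ≤ i ∧ i ≤ n ∧ ∃ x y, c = changeOfBasis (B (i - 1)) (B i) x y ∨
    c = changeOfBasis (B i) (B (i - 1)) x y}

end Johnson

end

/-!
Let `T_j` be the sum of the transpositions in `S_j`. On an irreducible representation of `S_j` it
acts by the scalar that the Young symmetrizer determines, so every element of `B i` is a joint
eigenvector of `T_1, …, T_i` that lies in some `F^w`. Such joint eigenspaces are at most lines: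
splitting a function by whether `i` belongs to the set, the two parts cannot share an eigenvalue of
the Jucys–Murphy element `T_i - T_{i-1}`, because a function on the `(m + 1)`-subsets of a set with
at most `2 * m + 1` elements is zero if for every `m`-subset its values on the supersets sum to
zero.

Since the `T_j` are self-adjoint, an element of `B (i - 1)` that is not orthogonal to a given
element of `B i` shares its eigenvalues and its suffix. There are at most two lines of such
functions, one for each possibility at the place `i`, so `[B_{i-1}]_{B_i}` and its inverse have at
most `2 * n.choose k` nonzero entries. Diagrams with three rows do not occur in `F`, and `T_n` tells
the two-row diagrams apart, so each component is spanned by elements of `B n`. Passing from `B 1` up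
to `B n`, discarding the coordinates outside of the chosen components, and returning to `B 1` takes
`4 * (n - 1) * n.choose k` operations.
-/

noncomputable section

namespace Johnson

open Equiv

/-! ### Circuits -/

namespace Circuit

variable {ι κ κ' : Type} {K : Set ℂ} {m m' : ℕ} {g : (ι → ℂ) → κ → ℂ}

theorem results_concat (P : Circuit ι κ) (I : Instruction ι) (out : κ' → Operand ι) (v : ι → ℂ) :
    (mk (P.instructions ++ [I]) out).results v = P.results v ++
      [I.a.eval v (P.results v) * I.b.eval v (P.results v) + I.c.eval v (P.results v)] := by
  simp [results]

theorem length_results (P : Circuit ι κ) (v : ι → ℂ) : (P.results v).length = P.cost := by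
  obtain ⟨L, out⟩ := P
  induction L using List.reverseRecOn with
  | nil => rfl
  | append_singleton L I ih => simpa [results_concat ⟨L, out⟩, cost] using ih

/-- The map `g` is computed by a circuit with at most `m` operations and constants in `K`.
The circuit can be continued: its outputs keep their values when further results `mem` are
appended to the memory. -/
def Computes (K : Set ℂ) (m : ℕ) (g : (ι → ℂ) → κ → ℂ) : Prop :=
  ∃ P : Circuit ι κ, P.ConstantsIn K ∧ P.cost ≤ m ∧
    ∀ v mem y, (P.output y).eval v (P.results v ++ mem) = g v y

theorem Computes.exists_eval_eq (h : Computes K m g) :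
    ∃ P : Circuit ι κ, P.ConstantsIn K ∧ P.cost ≤ m ∧ ∀ v, P.eval v = g v := by
  obtain ⟨P, hK, hm, hP⟩ := h
  refine ⟨P, hK, hm, fun v => funext fun y => ?_⟩
  simpa only [List.append_nil] using! hP v [] y

theorem computes_id (K : Set ℂ) : Computes K 0 (fun v : ι → ℂ => v) :=
  ⟨⟨[], .input⟩, ⟨by simp, by simp⟩, le_rfl, fun _ _ _ => rfl⟩

theorem Computes.mono (h : Computes K m g) (hm : m ≤ m') : Computes K m' g := by
  obtain ⟨P, hK, hP, he⟩ := h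
  exact ⟨P, hK, hP.trans hm, he⟩

theorem Computes.reindex (h : Computes K m g) (e : κ' → κ) :
    Computes K m (fun v y => g v (e y)) := by
  obtain ⟨P, hK, hm, hP⟩ := h
  exact ⟨⟨P.instructions, P.output ∘ e⟩, ⟨hK.1, fun y => hK.2 (e y)⟩, hm,
    fun v mem y => hP v mem (e y)⟩

theorem Computes.sumElim (h : Computes K m g) {c : κ' → ℂ} (hc : ∀ x, c x ∈ K) :
    Computes K m (fun v => Sum.elim (g v) c) := by
  obtain ⟨P, hK, hm, hP⟩ := h
  refine ⟨⟨P.instructions, Sum.elim P.output (.const ∘ c)⟩, ⟨hK.1, ?_⟩, hm, ?_⟩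
  · rintro (y | x) d hd
    · exact hK.2 y d hd
    · obtain rfl : c x = d := by simpa using hd
      exact hc x
  · rintro v mem (y | x)
    · exact hP v mem y
    · rfl

theorem Computes.ite_zero (h : Computes K m g) (h0 : 0 ∈ K) (p : κ → Prop) [DecidablePred p] :
    Computes K m (fun v y => if p y then g v y else 0) := by
  convert (h.sumElim (c := fun _ : Unit => 0) fun _ => h0).reindex
    (fun y => if p y then .inl y else .inr ()) using 3 with v y
  split_ifs <;> rfl

theorem Computes.update_mul_add [DecidableEq κ] (h : Computes K m g) {c : ℂ} (hc : c ∈ K)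
    (x y z : κ) :
    Computes K (m + 1) (fun v => Function.update (g v) x (c * g v y + g v z)) := by
  obtain ⟨P, hK, hm, hP⟩ := h
  refine ⟨⟨P.instructions ++ [⟨.const c, P.output y, P.output z⟩],
    Function.update P.output x (.result P.cost)⟩, ⟨?_, ?_⟩, by simpa [cost] using hm,
    fun v mem w => ?_⟩
  · intro I hI d hd
    rcases List.mem_append.1 hI with hI | hI
    · exact hK.1 I hI d hd
    · obtain rfl := List.mem_singleton.1 hI
      rcases hd with hd | hd | hd
      · obtain rfl : c = d := by simpa using hd
        exact hc
      · exact hK.2 y d hd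
      · exact hK.2 z d hd
  · intro w d hd
    by_cases hw : w = x
    · simp [hw] at hd
    · exact hK.2 w d (by simpa [hw] using hd)
  · have hy := hP v [] y
    have hz := hP v [] z
    rw [List.append_nil] at hy hz
    rw [results_concat, List.append_assoc, hy, hz]
    by_cases hw : w = x
    · simp [hw, Operand.eval, ← length_results P v]
    · simpa [hw] using hP v _ w

open Classical in
/-- The positions of the nonzero entries of a matrix. Multiplying by the matrix takes one
operation for each of them. -/
def nonzeroEntries {R : Type*} [Zero R] [Fintype κ] [Fintype κ'] (M : Matrix κ' κ R) :
    Finset (κ' × κ) :=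
  {e | M e.1 e.2 ≠ 0}

theorem Computes.mulVec [Fintype κ] [Fintype κ'] (h : Computes K m g) (h0 : 0 ∈ K)
    {M : Matrix κ' κ ℂ} (hM : ∀ x y, M x y ∈ K) :
    Computes K (m + (nonzeroEntries M).card) (fun v => M.mulVec (g v)) := by
  classical
  have partialSums (S : Finset (κ' × κ)) : Computes K (m + S.card)
      (fun v => Sum.elim (g v) fun x => ∑ e ∈ S with e.1 = x, M e.1 e.2 * g v e.2) := by
    induction S using Finset.induction_on with
    | empty => simpa using h.sumElim (c := fun _ : κ' => 0) fun _ => h0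
    | insert e S he ih =>
      convert ih.update_mul_add (hM e.1 e.2) (.inr e.1) (.inl e.2) (.inr e.1) using 1
      · rw [Finset.card_insert_of_notMem he, add_assoc]
      · funext v o
        rcases o with y | x
        · simp
        · rcases eq_or_ne e.1 x with rfl | hx
          · simp [Finset.filter_insert, Finset.sum_insert, he]
          · simp [Finset.filter_insert, hx, hx.symm]
  convert (partialSums (nonzeroEntries M)).reindex .inr using 3 with v x
  calc M.mulVec (g v) x = ∑ e : κ' × κ with e.1 = x, M e.1 e.2 * g v e.2 := by
        simp only [Matrix.mulVec, dotProduct, Finset.sum_filter, Fintype.sum_prod_type,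
          Finset.sum_ite_irrel, Finset.sum_const_zero, Finset.sum_ite_eq', Finset.mem_univ, if_true]
    _ = ∑ e ∈ nonzeroEntries M with e.1 = x, M e.1 e.2 * g v e.2 := by
        rw [nonzeroEntries, Finset.filter_comm]
        exact (Finset.sum_filter_of_ne fun e _ he => left_ne_zero_of_mul he).symm

theorem Computes.basis_chain {σ E : Type} [Fintype κ] [NormedAddCommGroup E]
    [InnerProductSpace ℂ E] {φ : (σ → ℂ) → E} (b : ℕ → OrthonormalBasis κ ℂ E) {r l : ℕ}
    (h : Computes K m fun v => (b 0).repr (φ v)) (h0 : 0 ∈ K)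
    (hK : ∀ i < l, ∀ x y, (b (i + 1)).toBasis.toMatrix (b i) x y ∈ K)
    (hr : ∀ i < l, (nonzeroEntries ((b (i + 1)).toBasis.toMatrix (b i))).card ≤ r) :
    Computes K (m + l * r) fun v => (b l).repr (φ v) := by
  induction l with
  | zero => simpa using h
  | succ l ih =>
    have previous := ih (fun i hi => hK i (by omega)) (fun i hi => hr i (by omega))
    convert (previous.mulVec h0 (hK l l.lt_succ_self)).mono (m' := m + (l + 1) * r) ?_
      using 2 with v
    · simpa using!
        ((b l).toBasis.toMatrix_mulVec_repr (b (l + 1)).toBasis (φ v)).symm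
    · linarith [hr l l.lt_succ_self]

end Circuit

/-! ### Young symmetrizers -/

/-- The sum of `χ g • g` over a subgroup, in the group algebra. The row sum and the column sum of
a tableau are the cases of the trivial character and of the sign. -/
def charSum {R G : Type*} [CommSemiring R] [Group G] [Fintype G] (S : Subgroup G) (χ : G →* R) :
    MonoidAlgebra R G :=
  open Classical in ∑ g : S, MonoidAlgebra.single (g : G) (χ g)

section CharSum

variable {R G : Type*} [CommSemiring R] [Group G] [Fintype G] {S : Subgroup G}

theorem of_mul_charSum (χ : G →* R) {g : G} (hg : g ∈ S) :
    MonoidAlgebra.of R G g * charSum S χ = χ g⁻¹ • charSum S χ := by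
  classical
  rw [charSum, Finset.mul_sum, Finset.smul_sum, ← Equiv.sum_comp (Equiv.mulLeft (⟨g, hg⟩⁻¹ : S))]
  simp [MonoidAlgebra.single_mul_single, MonoidAlgebra.smul_single]

theorem charSum_mul_of (χ : G →* R) {g : G} (hg : g ∈ S) :
    charSum S χ * MonoidAlgebra.of R G g = χ g⁻¹ • charSum S χ := by
  classical
  rw [charSum, Finset.sum_mul, Finset.smul_sum, ← Equiv.sum_comp (Equiv.mulRight (⟨g, hg⟩⁻¹ : S))]
  simp [MonoidAlgebra.single_mul_single, MonoidAlgebra.smul_single, mul_comm]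

end CharSum

/-- The permutations that preserve the fibers of `f`: the row or column stabilizer of a tableau,
when `f` gives the row or the column of an entry. -/
def fiberStabilizer {α β : Type*} (f : α → β) : Subgroup (Perm α) where
  carrier := {σ | ∀ p, f (σ p) = f p}
  one_mem' _ := rfl
  mul_mem' hσ hτ p := (hσ _).trans (hτ p)
  inv_mem' {σ} hσ p := by simpa using (hσ (σ⁻¹ p)).symm

theorem swap_mem_fiberStabilizer {α β : Type*} [DecidableEq α] (f : α → β) {p q : α}
    (h : f p = f q) : swap p q ∈ fiberStabilizer f := by
  intro r
  rw [swap_apply_def]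
  split_ifs with hp hq
  · rw [hp, h]
  · rw [hq, h]
  · rfl

section YoungSymmetrizer

open MonoidAlgebra (of)

variable {j : ℕ} {μ : YoungDiagram} {t : Tableau j μ} {p q : Fin j}

/-- The sum of the permutations that preserve the rows of `t`. -/
def rowSum (t : Tableau j μ) : MonoidAlgebra ℂ (Perm (Fin j)) :=
  charSum (fiberStabilizer fun p => (t p).1.1) 1

/-- The signed sum of the permutations that preserve the columns of `t`. -/
def colSum (t : Tableau j μ) : MonoidAlgebra ℂ (Perm (Fin j)) :=
  charSum (fiberStabilizer fun p => (t p).1.2)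
    (((Int.castRingHom ℂ : ℤ →* ℂ).comp (Units.coeHom ℤ)).comp Perm.sign)

theorem youngSymmetrizer_eq_rowSum_mul_colSum (t : Tableau j μ) :
    youngSymmetrizer t = rowSum t * colSum t := by
  classical
  rw [youngSymmetrizer, rowSum, colSum, charSum, charSum]
  congr 1 <;> exact Finset.sum_subtype _ (fun σ => Finset.mem_filter_univ σ) _

theorem rowSum_mul_swap (h : (t p).1.1 = (t q).1.1) :
    rowSum t * of ℂ _ (swap p q) = rowSum t := by
  rw [rowSum, charSum_mul_of _ (swap_mem_fiberStabilizer (fun p => (t p).1.1) h),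
    MonoidHom.one_apply, one_smul]

theorem swap_mul_colSum (hpq : p ≠ q) (h : (t p).1.2 = (t q).1.2) :
    of ℂ _ (swap p q) * colSum t = -colSum t := by
  rw [colSum, of_mul_charSum _ (swap_mem_fiberStabilizer (fun p => (t p).1.2) h)]
  simp [Perm.sign_swap hpq]

theorem colSum_mul_swap (hpq : p ≠ q) (h : (t p).1.2 = (t q).1.2) :
    colSum t * of ℂ _ (swap p q) = -colSum t := by
  rw [colSum, charSum_mul_of _ (swap_mem_fiberStabilizer (fun p => (t p).1.2) h)]
  simp [Perm.sign_swap hpq]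

theorem rowSum_mul_swap_mul_colSum_eq_zero (hr : (t p).1.1 ≠ (t q).1.1)
    (hc : (t p).1.2 ≠ (t q).1.2) : rowSum t * of ℂ _ (swap p q) * colSum t = 0 := by
  wlog hlt : (t p).1.1 < (t q).1.1 generalizing p q
  · rw [swap_comm]
    exact this hr.symm hc.symm (lt_of_le_of_ne (not_lt.1 hlt) hr.symm)
  obtain ⟨s, hs⟩ : ∃ s, (t s).1 = ((t p).1.1, (t q).1.2) := by
    have corner : ((t p).1.1, (t q).1.2) ∈ μ.cells :=
      μ.isLowerSet (show _ ≤ (t q).1 from ⟨hlt.le, le_rfl⟩) (t q).2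
    exact ⟨t.symm ⟨_, corner⟩, by simp⟩
  have row_s : (t p).1.1 = (t s).1.1 := by rw [hs]
  have col_s : (t s).1.2 = (t q).1.2 := by rw [hs]
  have hsq : s ≠ q := fun h => hr (h ▸ row_s)
  have hsp : s ≠ p := fun h => hc (h ▸ col_s)
  have swaps : of ℂ _ (swap p s) * of ℂ _ (swap p q) = of ℂ _ (swap p q) * of ℂ _ (swap s q) := by
    rw [← map_mul, ← map_mul, mul_swap_eq_swap_mul (swap p q) s q, swap_apply_right,
      swap_apply_of_ne_of_ne hsp hsq, swap_comm s p]
  have eq_neg : rowSum t * of ℂ _ (swap p q) * colSum t =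
      -(rowSum t * of ℂ _ (swap p q) * colSum t) := by
    calc rowSum t * of ℂ _ (swap p q) * colSum t
        = rowSum t * (of ℂ _ (swap p s) * of ℂ _ (swap p q)) * colSum t := by
          rw [← mul_assoc, rowSum_mul_swap row_s]
      _ = rowSum t * of ℂ _ (swap p q) * (of ℂ _ (swap s q) * colSum t) := by
          rw [swaps]; simp only [mul_assoc]
      _ = -(rowSum t * of ℂ _ (swap p q) * colSum t) := by
          rw [swap_mul_colSum hsq col_s, mul_neg]
  have : IsAddTorsionFree (MonoidAlgebra ℂ (Perm (Fin j))) := .of_isTorsionFree ℂ _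
  exact self_eq_neg.1 eq_neg

/-- The factor by which the transposition of the entries of the boxes `c` and `d` acts when it
stands between the row sum and the column sum of a tableau. -/
def pairSign (c d : ℕ × ℕ) : ℤ :=
  if c.1 = d.1 then 1 else if c.2 = d.2 then -1 else 0

theorem rowSum_mul_swap_mul_colSum (t : Tableau j μ) (p q : Fin j) :
    rowSum t * of ℂ _ (swap p q) * colSum t =
      (pairSign (t p).1 (t q).1 : ℂ) • youngSymmetrizer t := by
  rw [youngSymmetrizer_eq_rowSum_mul_colSum, pairSign]
  split_ifs with hr hc
  · rw [rowSum_mul_swap hr, Int.cast_one, one_smul]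
  · have hpq : p ≠ q := fun h => hr (h ▸ rfl)
    rw [mul_assoc, swap_mul_colSum hpq hc, mul_neg, Int.cast_neg, Int.cast_one, neg_one_smul]
  · rw [rowSum_mul_swap_mul_colSum_eq_zero hr hc, Int.cast_zero, zero_smul]

/-- The sum of the transpositions `(p q)` over all ordered pairs, `p = q` included. -/
def transpositionSum (α : Type*) [Fintype α] [DecidableEq α] : MonoidAlgebra ℂ (Perm α) :=
  ∑ p, ∑ q, of ℂ _ (swap p q)

theorem commute_transpositionSum {α : Type*} [Fintype α] [DecidableEq α]
    (x : MonoidAlgebra ℂ (Perm α)) : Commute (transpositionSum α) x := by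
  refine MonoidAlgebra.induction_on (motive := Commute (transpositionSum α)) x (fun σ => ?_)
    (fun _ _ => Commute.add_right) (fun c _ h => h.smul_right c)
  calc transpositionSum α * of ℂ _ σ = ∑ p, ∑ q, of ℂ _ (swap (σ p) (σ q)) * of ℂ _ σ := by
        rw [transpositionSum, Finset.sum_mul, ← Equiv.sum_comp σ]
        refine Finset.sum_congr rfl fun p _ => ?_
        rw [Finset.sum_mul, ← Equiv.sum_comp σ]
    _ = of ℂ _ σ * transpositionSum α := by
        simp only [transpositionSum, Finset.mul_sum, ← map_mul, mul_swap_eq_swap_mul]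

/-- The eigenvalue of the sum of all transpositions on `V_μ`: the number of boxes plus twice the
sum of their contents, since the pairs of equal boxes count once. -/
def swapEigenvalue (μ : YoungDiagram) : ℤ := ∑ c ∈ μ.cells, ∑ d ∈ μ.cells, pairSign c d

theorem transpositionSum_mul_youngSymmetrizer (t : Tableau j μ) :
    transpositionSum (Fin j) * youngSymmetrizer t =
      (swapEigenvalue μ : ℂ) • youngSymmetrizer t := by
  have sum_boxes (f : ℕ × ℕ → ℤ) : ∑ p, f (t p).1 = ∑ c ∈ μ.cells, f c := by
    rw [← Finset.sum_coe_sort μ.cells f]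
    exact Equiv.sum_comp t (fun c => f c.1)
  have sum_pairs : ∑ p, ∑ q, pairSign (t p).1 (t q).1 = swapEigenvalue μ := by
    rw [swapEigenvalue, ← sum_boxes]
    exact Finset.sum_congr rfl fun p _ => sum_boxes _
  conv_lhs => rw [youngSymmetrizer_eq_rowSum_mul_colSum, ← mul_assoc,
    (commute_transpositionSum _).eq, transpositionSum]
  simp only [Finset.mul_sum, Finset.sum_mul, rowSum_mul_swap_mul_colSum, ← Finset.sum_smul]
  rw [← sum_pairs]
  norm_cast

theorem transpositionSum_sub_eigenvalue_smul_specht (x : specht t) :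
    (transpositionSum (Fin j) - algebraMap ℂ _ (swapEigenvalue μ : ℂ)) • x = 0 := by
  obtain ⟨x, hx⟩ := x
  obtain ⟨r, rfl⟩ := Ideal.mem_span_singleton'.1 hx
  refine Subtype.ext ?_
  rw [Submodule.coe_smul, smul_eq_mul, sub_mul, ← mul_assoc, (commute_transpositionSum r).eq,
    mul_assoc, transpositionSum_mul_youngSymmetrizer, ← Algebra.smul_def, mul_smul_comm, sub_self,
    Submodule.coe_zero]

end YoungSymmetrizer

/-! ### Isotypic components -/

section Isotypic

variable {R M S : Type*} [Ring R] [AddCommGroup M] [Module R M] [AddCommGroup S] [Module R S]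

theorem smul_eq_zero_of_mem_isotypicComponent {r : R} (hr : ∀ s : S, r • s = 0) {v : M}
    (hv : v ∈ isotypicComponent R M S) : r • v = 0 := by
  rw [isotypicComponent, sSup_eq_iSup'] at hv
  refine Submodule.iSup_induction _ (motive := fun v => r • v = 0) hv ?_ (smul_zero r)
    fun v w hv hw => by rw [smul_add, hv, hw, add_zero]
  rintro ⟨m, ⟨e⟩⟩ v hv
  have : r • (⟨v, hv⟩ : m) = 0 := e.injective (by rw [map_smul, hr, map_zero])
  exact congrArg Subtype.val this

theorem isotypicComponent_span_singleton_eq_bot [IsSemisimpleRing R] {r : R}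
    (hr : ∀ v : M, r • v = 0) : isotypicComponent R M (Ideal.span {r}) = ⊥ := by
  refine le_bot_iff.1 (sSup_le ?_)
  rintro m ⟨e⟩ v hv
  obtain ⟨g, hg⟩ := IsSemisimpleModule.extension_property (Ideal.span {r}).subtype
    (Ideal.span {r}).injective_subtype (m.subtype ∘ₗ e.symm.toLinearMap)
  obtain ⟨s, hs⟩ := Ideal.mem_span_singleton'.1 (e ⟨v, hv⟩).2
  calc v = g (e ⟨v, hv⟩) := by simpa using (LinearMap.congr_fun hg (e ⟨v, hv⟩)).symm
    _ = s • r • g 1 := by rw [← hs, ← map_smul, ← map_smul, smul_eq_mul, smul_eq_mul, mul_one]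
    _ = 0 := by rw [hr, smul_zero]

end Isotypic

variable {n k : ℕ}

/-- The sum of the transpositions `(p q)` over all ordered pairs of the first `j` places, `p = q`
included, as an operator on `F n k`. -/
def swapSum (n k j : ℕ) : Module.End ℂ (F n k) :=
  ∑ p : Fin n with p.1 < j, ∑ q : Fin n with q.1 < j, rep n k (swap p q)

theorem viaEmbeddingHom_swap {α β : Type*} [DecidableEq α] [DecidableEq β] (e : α ↪ β) (p q : α) :
    Perm.viaEmbeddingHom e (swap p q) = swap (e p) (e q) := by
  ext r
  rw [Perm.viaEmbeddingHom_apply]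
  by_cases hr : r ∈ Set.range e
  · obtain ⟨r, rfl⟩ := hr
    rw [Perm.viaEmbedding_apply, e.injective.swap_apply]
  · rw [Perm.viaEmbedding_apply_of_notMem _ _ _ hr, swap_apply_of_ne_of_ne]
    · exact fun h => hr ⟨p, h.symm⟩
    · exact fun h => hr ⟨q, h.symm⟩

theorem asAlgebraHom_of_swap {j : ℕ} (hj : j ≤ n) (p q : Fin j) :
    (repRestrict n k hj).asAlgebraHom (MonoidAlgebra.of ℂ _ (swap p q)) =
      rep n k (swap (p.castLE hj) (q.castLE hj)) := by
  rw [Representation.asAlgebraHom_of]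
  exact congrArg (rep n k) (viaEmbeddingHom_swap (Fin.castLEEmb hj) p q)

theorem asAlgebraHom_transpositionSum {j : ℕ} (hj : j ≤ n) :
    (repRestrict n k hj).asAlgebraHom (transpositionSum (Fin j)) = swapSum n k j := by
  have sum_castLE (g : Fin n → Module.End ℂ (F n k)) :
      ∑ p : Fin j, g (p.castLE hj) = ∑ p : Fin n with p.1 < j, g p := by
    refine Finset.sum_nbij (Fin.castLE hj) (fun p _ => by simp)
      (Fin.castLE_injective hj).injOn (fun p hp => ?_) (fun _ _ => rfl)
    exact ⟨⟨p, by simpa using hp⟩, by simp, rfl⟩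
  simp only [transpositionSum, swapSum, map_sum, asAlgebraHom_of_swap, ← sum_castLE]

theorem isotypic_le_eigenspace {j : ℕ} (hj : j ≤ n) (μ : YoungDiagram) :
    isotypic n k hj μ ≤ Module.End.eigenspace (swapSum n k j) (swapEigenvalue μ : ℂ) := by
  refine iSup_le fun t => ?_
  rintro _ ⟨v, hv, rfl⟩
  have killed := congrArg (repRestrict n k hj).asModuleEquiv
    (smul_eq_zero_of_mem_isotypicComponent (transpositionSum_sub_eigenvalue_smul_specht (t := t))
      hv)
  rw [Representation.asModuleEquiv_map_smul, map_sub, map_zero, asAlgebraHom_transpositionSum,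
    AlgHom.commutes, LinearMap.sub_apply, sub_eq_zero] at killed
  exact Module.End.mem_eigenspace_iff.2 killed

theorem mem_smul_iff (σ : Perm (Fin n)) (x : X n k) (p : Fin n) :
    p ∈ (σ • x).1 ↔ σ⁻¹ p ∈ x.1 := by
  rw [Set.powersetCard.coe_smul, ← Finset.inv_smul_mem_iff, Perm.smul_def]

theorem swap_smul_eq_self {p q : Fin n} {x : X n k} (h : p ∈ x.1 ↔ q ∈ x.1) :
    swap p q • x = x := by
  ext r
  rw [mem_smul_iff, swap_inv, swap_apply_def]
  split_ifs with hp hq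
  · rw [hp, h]
  · rw [hq, h]
  · rfl

theorem rep_deltaBasis (σ : Perm (Fin n)) (x : X n k) :
    rep n k σ (deltaBasis n k x) = deltaBasis n k (σ • x) := by
  ext y
  change deltaBasis n k x (σ⁻¹ • y) = deltaBasis n k (σ • x) y
  simp [deltaBasis, PiLp.single_apply, inv_smul_eq_iff]

theorem asAlgebraHom_colSum_eq_zero {j : ℕ} (hj : j ≤ n) {μ : YoungDiagram} (hμ : (2, 0) ∈ μ)
    (t : Tableau j μ) : (repRestrict n k hj).asAlgebraHom (colSum t) = 0 := by
  have kills_of_iff {p q : Fin j} (hpq : p ≠ q) (hc : (t p).1.2 = (t q).1.2) {x : X n k}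
      (hx : p.castLE hj ∈ x.1 ↔ q.castLE hj ∈ x.1) :
      (repRestrict n k hj).asAlgebraHom (colSum t) (deltaBasis n k x) = 0 := by
    have eq_neg := congrArg (fun u => (repRestrict n k hj).asAlgebraHom u (deltaBasis n k x))
      (colSum_mul_swap hpq hc)
    simp only [map_mul, Module.End.mul_apply, asAlgebraHom_of_swap, map_neg, LinearMap.neg_apply,
      rep_deltaBasis, swap_smul_eq_self hx] at eq_neg
    have : IsAddTorsionFree (F n k) := .of_isTorsionFree ℂ _
    exact self_eq_neg.1 eq_neg
  have exists_entry (a : ℕ) (ha : a ≤ 2) : ∃ p, (t p).1 = (a, 0) :=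
    ⟨t.symm ⟨(a, 0), μ.isLowerSet (show (a, 0) ≤ (2, 0) from ⟨ha, le_rfl⟩) hμ⟩, by simp⟩
  obtain ⟨p, hp⟩ := exists_entry 0 (by norm_num)
  obtain ⟨q, hq⟩ := exists_entry 1 (by norm_num)
  obtain ⟨r, hr⟩ := exists_entry 2 (by norm_num)
  have hpq : p ≠ q := by rintro rfl; simp [hp] at hq
  have hpr : p ≠ r := by rintro rfl; simp [hp] at hr
  have hqr : q ≠ r := by rintro rfl; simp [hq] at hr
  refine (deltaBasis n k).toBasis.ext fun x => ?_
  rw [OrthonormalBasis.coe_toBasis, LinearMap.zero_apply]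
  -- Of the three places `p`, `q`, `r`, two lie both in `x` or both outside of `x`.
  by_cases h₁ : p.castLE hj ∈ x.1 ↔ q.castLE hj ∈ x.1
  · exact kills_of_iff hpq (by rw [hp, hq]) h₁
  by_cases h₂ : p.castLE hj ∈ x.1 ↔ r.castLE hj ∈ x.1
  · exact kills_of_iff hpr (by rw [hp, hr]) h₂
  · exact kills_of_iff hqr (by rw [hq, hr]) (by tauto)

theorem isotypic_eq_bot_of_mem {j : ℕ} (hj : j ≤ n) {μ : YoungDiagram} (hμ : (2, 0) ∈ μ) :
    isotypic n k hj μ = ⊥ := by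
  have symmetrizer_smul (t : Tableau j μ) (v : (repRestrict n k hj).asModule) :
      youngSymmetrizer t • v = 0 := by
    apply (repRestrict n k hj).asModuleEquiv.injective
    rw [Representation.asModuleEquiv_map_smul, youngSymmetrizer_eq_rowSum_mul_colSum, map_mul,
      asAlgebraHom_colSum_eq_zero hj hμ t, mul_zero, LinearMap.zero_apply, map_zero]
  refine le_bot_iff.1 (iSup_le fun t => ?_)
  rw [specht, isotypicComponent_span_singleton_eq_bot (symmetrizer_smul t),
    Submodule.restrictScalars_bot, Submodule.map_bot]

theorem inner_rep_rep (σ : Perm (Fin n)) (f g : F n k) :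
    inner ℂ (rep n k σ f) (rep n k σ g) = inner ℂ f g := by
  simp only [PiLp.inner_apply]
  exact Equiv.sum_comp (MulAction.toPerm σ⁻¹) fun x => inner ℂ (f x) (g x)

theorem isSymmetric_rep_swap (p q : Fin n) : (rep n k (swap p q)).IsSymmetric := fun f g => by
  rw [← inner_rep_rep (swap p q), ← Module.End.mul_apply, ← map_mul, swap_mul_self, map_one,
    Module.End.one_apply]

theorem isSymmetric_swapSum (n k j : ℕ) : (swapSum n k j).IsSymmetric :=
  Finset.sum_induction _ LinearMap.IsSymmetric (fun _ _ => .add) .zero fun p _ =>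
    Finset.sum_induction _ LinearMap.IsSymmetric (fun _ _ => .add) .zero fun q _ =>
      isSymmetric_rep_swap p q

/-! ### Two-row diagrams -/

section TwoRow

variable {p q p' q' : ℕ}

theorem mem_twoRow {h : q ≤ p} {c : ℕ × ℕ} :
    c ∈ twoRow p q h ↔ c.1 = 0 ∧ c.2 < p ∨ c.1 = 1 ∧ c.2 < q := by
  obtain ⟨a, b⟩ := c
  rw [twoRow, YoungDiagram.mem_ofRowLens]
  rcases a with _ | _ | a <;> simp

theorem exists_eq_twoRow {μ : YoungDiagram} (hμ : (2, 0) ∉ μ) :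
    ∃ p q h, μ = twoRow p q h := by
  refine ⟨μ.rowLen 0, μ.rowLen 1, μ.rowLen_anti 0 1 zero_le_one, ?_⟩
  ext ⟨a, b⟩
  rw [YoungDiagram.mem_cells, YoungDiagram.mem_cells, mem_twoRow]
  rcases a with _ | _ | a
  · simp [YoungDiagram.mem_iff_lt_rowLen]
  · simp [YoungDiagram.mem_iff_lt_rowLen]
  · have : (a + 2, b) ∉ μ := fun h =>
      hμ (μ.isLowerSet (show (2, 0) ≤ (a + 2, b) from ⟨by simp, b.zero_le⟩) h)
    simpa using this

theorem sum_cells_twoRow {M : Type*} [AddCommMonoid M] (h : q ≤ p) (f : ℕ × ℕ → M) :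
    ∑ c ∈ (twoRow p q h).cells, f c =
      ∑ b ∈ Finset.range p, f (0, b) + ∑ b ∈ Finset.range q, f (1, b) := by
  have cells_eq : (twoRow p q h).cells =
      {0} ×ˢ Finset.range p ∪ {1} ×ˢ Finset.range q := by
    ext c
    simp [mem_twoRow, -Finset.singleton_product]
  rw [cells_eq, Finset.sum_union (Finset.disjoint_product.2 (.inl (by simp))), Finset.sum_product,
    Finset.sum_product, Finset.sum_singleton, Finset.sum_singleton]

theorem card_twoRow (h : q ≤ p) : (twoRow p q h).card = p + q := by
  rw [YoungDiagram.card, Finset.card_eq_sum_ones, sum_cells_twoRow]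
  simp

theorem swapEigenvalue_twoRow (h : q ≤ p) :
    swapEigenvalue (twoRow p q h) = (p : ℤ) ^ 2 + (q : ℤ) ^ 2 - 2 * q := by
  have same_column : ∑ b ∈ Finset.range p, ∑ b' ∈ Finset.range q, pairSign (0, b) (1, b') = -q := by
    rw [Finset.sum_comm, Finset.sum_congr rfl (g := fun _ => -1)]
    · simp
    · intro b' hb'
      have : b' < p := (Finset.mem_range.1 hb').trans_le h
      simp [pairSign, this]
  have same_column' :
      ∑ b ∈ Finset.range q, ∑ b' ∈ Finset.range p, pairSign (1, b) (0, b') = -q := by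
    rw [Finset.sum_comm, ← same_column]
    simp only [pairSign, eq_comm]
  simp only [swapEigenvalue, sum_cells_twoRow, Finset.sum_add_distrib, same_column, same_column']
  simp only [pairSign, if_true, Finset.sum_const, Finset.card_range, nsmul_eq_mul]
  ring

theorem eq_of_swapEigenvalue_twoRow_eq {h : q ≤ p} {h' : q' ≤ p'} (hcard : p + q = p' + q')
    (heq : swapEigenvalue (twoRow p q h) = swapEigenvalue (twoRow p' q' h')) : q = q' := by
  rw [swapEigenvalue_twoRow, swapEigenvalue_twoRow] at heq
  zify at h h' hcard ⊢
  have hp : (p : ℤ) = p' + q' - q := by linarith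
  rw [hp] at h heq
  have factored : (q - q' : ℤ) * (q - p' - 1) = 0 := by linarith
  rcases mul_eq_zero.1 factored with hq | hq <;> linarith

theorem isotypic_twoRow_isOrtho {j : ℕ} (hj : j ≤ n) {h : q ≤ p} {h' : q' ≤ p'}
    (hcard : p + q = p' + q') (hne : q ≠ q') :
    isotypic n k hj (twoRow p q h) ⟂ isotypic n k hj (twoRow p' q' h') := by
  have eigenvalue_ne : (swapEigenvalue (twoRow p q h) : ℂ) ≠ swapEigenvalue (twoRow p' q' h') :=
    fun heq => hne (eq_of_swapEigenvalue_twoRow_eq hcard (Int.cast_injective heq))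
  exact ((isSymmetric_swapSum n k j).orthogonalFamily_eigenspaces.isOrtho eigenvalue_ne).mono
    (isotypic_le_eigenspace hj _) (isotypic_le_eigenspace hj _)

end TwoRow

/-! ### Functions on sets of fixed size -/

section SupersetSum

variable {α M : Type*} [DecidableEq α] [AddCommGroup M]

/-- The sum of `v x` over the sets `x` of size `m` with `s ⊆ x ⊆ A`. -/
def supersetSum (A : Finset α) (m : ℕ) (v : Finset α → M) (s : Finset α) : M :=
  ∑ x ∈ A.powersetCard m with s ⊆ x, v x

variable {A : Finset α} {m : ℕ}

theorem supersetSum_of_mem_powersetCard {x : Finset α} (hx : x ∈ A.powersetCard m)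
    (v : Finset α → M) : supersetSum A m v x = v x := by
  have filter_eq : {y ∈ A.powersetCard m | x ⊆ y} = {x} := by
    ext y
    simp only [Finset.mem_filter, Finset.mem_singleton]
    constructor
    · rintro ⟨hy, hxy⟩
      refine (Finset.eq_of_subset_of_card_le hxy ?_).symm
      rw [(Finset.mem_powersetCard.1 hx).2, (Finset.mem_powersetCard.1 hy).2]
    · rintro rfl
      exact ⟨hx, subset_rfl⟩
  rw [supersetSum, filter_eq, Finset.sum_singleton]

theorem sum_supersetSum_insert (A : Finset α) (m : ℕ) (v : Finset α → M) (s : Finset α) :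
    ∑ p ∈ A \ s, supersetSum A m v (insert p s) = (m - s.card) • supersetSum A m v s := by
  simp only [supersetSum, Finset.insert_subset_iff, Finset.smul_sum]
  rw [Finset.sum_comm' (t' := {x ∈ A.powersetCard m | s ⊆ x}) (s' := fun x => x \ s)]
  · refine Finset.sum_congr rfl fun x hx => ?_
    obtain ⟨hx, hsx⟩ := Finset.mem_filter.1 hx
    rw [Finset.sum_const, Finset.card_sdiff_of_subset hsx, (Finset.mem_powersetCard.1 hx).2]
  · intro p x
    simp only [Finset.mem_sdiff, Finset.mem_filter, Finset.mem_powersetCard]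
    grind

theorem sum_neg_one_pow_smul_supersetSum (A : Finset α) (m : ℕ) (v : Finset α → M)
    (c : Finset α) :
    ∑ t ∈ c.powerset, (-1 : ℤ) ^ t.card • supersetSum A m v t =
      ∑ x ∈ A.powersetCard m with Disjoint c x, v x := by
  simp only [supersetSum, Finset.smul_sum]
  rw [Finset.sum_comm' (t' := A.powersetCard m) (s' := fun x => (c ∩ x).powerset)]
  · simp only [← Finset.sum_smul, Finset.sum_powerset_neg_one_pow_card, Finset.sum_filter,
      Finset.disjoint_iff_inter_eq_empty, ite_smul, one_smul, zero_smul]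
  · intro t x
    simp only [Finset.mem_filter, Finset.mem_powerset, Finset.subset_inter_iff]
    tauto

theorem supersetSum_eq_zero [IsAddTorsionFree M] {v : Finset α → M}
    (hv : ∀ s ∈ A.powersetCard m, ∑ p ∈ A \ s, v (insert p s) = 0) {s : Finset α} (hs : s ⊆ A)
    (hsm : s.card ≤ m) : supersetSum A (m + 1) v s = 0 := by
  induction hd : m - s.card generalizing s with
  | zero =>
    have hcard : s.card = m := by omega
    have hsum := sum_supersetSum_insert A (m + 1) v s
    rw [hcard, Nat.add_sub_cancel_left, one_smul] at hsum
    rw [← hsum, ← hv s (Finset.mem_powersetCard.2 ⟨hs, hcard⟩)]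
    refine Finset.sum_congr rfl fun p hp => supersetSum_of_mem_powersetCard ?_ v
    obtain ⟨hpA, hps⟩ := Finset.mem_sdiff.1 hp
    exact Finset.mem_powersetCard.2 ⟨Finset.insert_subset hpA hs, by
      rw [Finset.card_insert_of_notMem hps, hcard]⟩
  | succ d ih =>
    have hsum : (m + 1 - s.card) • supersetSum A (m + 1) v s = 0 := by
      rw [← sum_supersetSum_insert]
      refine Finset.sum_eq_zero fun p hp => ?_
      obtain ⟨hpA, hps⟩ := Finset.mem_sdiff.1 hp
      have hcard := Finset.card_insert_of_notMem hps
      exact ih (Finset.insert_subset hpA hs) (by omega) (by omega)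
    exact (smul_eq_zero.1 hsum).resolve_left (by omega)

-- By inclusion–exclusion over `A \ x`, `v x` is an alternating sum of sums over supersets.
theorem eq_zero_of_sum_insert_eq_zero [IsAddTorsionFree M] (hA : A.card ≤ 2 * m + 1)
    {v : Finset α → M} (hv : ∀ s ∈ A.powersetCard m, ∑ p ∈ A \ s, v (insert p s) = 0)
    {x : Finset α} (hx : x ∈ A.powersetCard (m + 1)) : v x = 0 := by
  obtain ⟨hxA, hxm⟩ := Finset.mem_powersetCard.1 hx
  have hcard : (A \ x).card ≤ m := by
    rw [Finset.card_sdiff_of_subset hxA]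
    omega
  have filter_eq : {y ∈ A.powersetCard (m + 1) | Disjoint (A \ x) y} = {x} := by
    ext y
    simp only [Finset.mem_filter, Finset.mem_singleton]
    constructor
    · rintro ⟨hy, hxy⟩
      obtain ⟨hyA, hym⟩ := Finset.mem_powersetCard.1 hy
      refine Finset.eq_of_subset_of_card_le (fun p hp => ?_) (by rw [hxm, hym])
      by_contra hpx
      exact Finset.disjoint_left.1 hxy (Finset.mem_sdiff.2 ⟨hyA hp, hpx⟩) hp
    · rintro rfl
      exact ⟨hx, Finset.sdiff_disjoint⟩
  calc v x = ∑ t ∈ (A \ x).powerset, (-1 : ℤ) ^ t.card • supersetSum A (m + 1) v t := by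
        rw [sum_neg_one_pow_smul_supersetSum, filter_eq, Finset.sum_singleton]
    _ = 0 := by
        refine Finset.sum_eq_zero fun t ht => ?_
        have htx := Finset.mem_powerset.1 ht
        rw [supersetSum_eq_zero hv (htx.trans Finset.sdiff_subset)
          ((Finset.card_le_card htx).trans hcard), smul_zero]

end SupersetSum

/-! ### Gelfand–Tsetlin spaces -/

theorem rep_apply (σ : Perm (Fin n)) (f : F n k) (x : X n k) : rep n k σ f x = f (σ⁻¹ • x) := rfl

/-- The Jucys–Murphy element of the place `i`, the sum of the transpositions `(p i)` with `p < i`,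
as an operator on `F n k`. -/
def jucysMurphy (n k : ℕ) (i : Fin n) : Module.End ℂ (F n k) :=
  ∑ p ∈ Finset.Iio i, rep n k (swap p i)

theorem jucysMurphy_apply (i : Fin n) (f : F n k) (x : X n k) :
    jucysMurphy n k i f x = ∑ p ∈ Finset.Iio i, f (swap p i • x) := by
  simp [jucysMurphy, rep_apply, LinearMap.sum_apply]

theorem swapSum_succ (n k : ℕ) (i : Fin n) :
    swapSum n k (i + 1) = swapSum n k i + 2 • jucysMurphy n k i + 1 := by
  have filter_succ : ({p | p.1 < i + 1} : Finset (Fin n)) =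
      Finset.cons i (Finset.Iio i) Finset.notMem_Iio_self := by
    ext p
    simp [le_iff_eq_or_lt, Fin.ext_iff]
  have filter_self : ({p | p.1 < i} : Finset (Fin n)) = Finset.Iio i := by
    ext p
    simp
  simp only [swapSum, filter_succ, filter_self, Finset.sum_cons, Finset.sum_add_distrib, swap_self,
    swap_comm i, jucysMurphy, two_smul]
  rw [← Perm.one_def, map_one]
  abel

theorem mem_suffixSpace {i : ℕ} {w : Set (Fin n)} {f : F n k} :
    f ∈ suffixSpace n k i w ↔
      ∀ x, f x ≠ 0 → ∀ p : Fin n, i ≤ p.val → (p ∈ x.1 ↔ p ∈ w) := by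
  have repr_apply (x : X n k) : (deltaBasis n k).toBasis.repr f x = f x := by
    simp [deltaBasis]
  rw [suffixSpace, ← OrthonormalBasis.coe_toBasis, Module.Basis.mem_span_image]
  simp only [Set.subset_def, Finset.mem_coe, Finsupp.mem_support_iff, repr_apply, Set.mem_ofPred_eq]

theorem suffixSpace_le_succ (i : ℕ) {w w' : Set (Fin n)}
    (h : ∀ p : Fin n, i + 1 ≤ p.val → (p ∈ w ↔ p ∈ w')) :
    suffixSpace n k i w ≤ suffixSpace n k (i + 1) w' := fun f hf =>
  mem_suffixSpace.2 fun x hx p hp => (mem_suffixSpace.1 hf x hx p (by omega)).trans (h p hp)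

theorem jucysMurphy_eigenvalue_eq_card {i : Fin n} {w : Set (Fin n)} {u : F n k}
    (hu : u ∈ suffixSpace n k i w) {c : ℂ} (hc : jucysMurphy n k i u = c • u) {x : X n k}
    (hx : u x ≠ 0) : c = (Finset.card {p ∈ Finset.Iio i | p ∈ x.1 ↔ i ∈ x.1} : ℂ) := by
  have summand (p : Fin n) : u (swap p i • x) = if p ∈ x.1 ↔ i ∈ x.1 then u x else 0 := by
    split_ifs with hp
    · rw [swap_smul_eq_self hp]
    · by_contra hne
      have hswap := mem_suffixSpace.1 hu _ hne i le_rfl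
      rw [mem_smul_iff, swap_inv, swap_apply_right] at hswap
      exact hp (hswap.trans (mem_suffixSpace.1 hu x hx i le_rfl).symm)
  have eval := congrArg (fun f : F n k => f x) hc
  simp only [jucysMurphy_apply, summand, ← Finset.sum_filter, Finset.sum_const, nsmul_eq_mul,
    PiLp.smul_apply, smul_eq_mul] at eval
  exact (mul_right_cancel₀ hx eval).symm

theorem sum_extend_insert_eq_zero {i : Fin n} {u : F n k} (hu : ∀ x, u x ≠ 0 → i ∉ x.1) {c : ℂ}
    (hc : jucysMurphy n k i u = c • u) {s : Finset (Fin n)} (hi : i ∉ s) (hs : s.card + 1 = k) :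
    ∑ p ∈ Finset.Iio i \ s, Function.extend Subtype.val u 0 (insert p s) = 0 := by
  let z : X n k :=
    ⟨insert i s, by rw [Set.powersetCard.mem_iff, Finset.card_insert_of_notMem hi, hs]⟩
  have hiz : i ∈ z.1 := Finset.mem_insert_self i s
  have hz : u z = 0 := by_contra fun h => hu z h hiz
  have eval := congrArg (fun f : F n k => f z) hc
  simp only [jucysMurphy_apply, PiLp.smul_apply, hz, smul_zero] at eval
  rw [← eval]
  refine Finset.sum_subset_zero_on_sdiff Finset.sdiff_subset (fun p hp => ?_) fun p hp => ?_
  · have hps : p ∈ s := by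
      rw [sdiff_sdiff_right_self] at hp
      exact Finset.mem_of_mem_inter_right hp
    rw [swap_smul_eq_self (iff_of_true (Finset.mem_insert_of_mem hps) hiz), hz]
  · obtain ⟨hpi, hps⟩ := Finset.mem_sdiff.1 hp
    have swap_smul : (swap p i • z).1 = insert p s := by
      ext q
      rw [mem_smul_iff, swap_inv, swap_apply_def]
      grind
    rw [← swap_smul, Subtype.val_injective.extend_apply]

theorem card_inter_Iio_eq_succ {i : Fin n} {x y : X n k} (hx : i ∉ x.1) (hy : i ∈ y.1)
    (hxy : ∀ p, i < p → (p ∈ x.1 ↔ p ∈ y.1)) :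
    (x.1 ∩ Finset.Iio i).card = (y.1 ∩ Finset.Iio i).card + 1 := by
  have sdiff_eq : y.1 \ Finset.Iio i = insert i (x.1 \ Finset.Iio i) := by
    ext p
    simp only [Finset.mem_sdiff, Finset.mem_insert, Finset.mem_Iio, not_lt]
    grind
  have split_x := Finset.card_inter_add_card_sdiff x.1 (Finset.Iio i)
  have split_y := Finset.card_inter_add_card_sdiff y.1 (Finset.Iio i)
  rw [Set.powersetCard.card_eq] at split_x split_y
  rw [sdiff_eq, Finset.card_insert_of_notMem (by simp [hx])] at split_y
  omega

theorem apply_eq_zero_of_jucysMurphy_eq_smul {i : Fin n} {w : Set (Fin n)} (hi : i ∉ w) {u : F n k}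
    (hu : u ∈ suffixSpace n k i w) {c : ℂ} (hc : jucysMurphy n k i u = c • u) {x : X n k}
    (hx : i.1 < 2 * (x.1 ∩ Finset.Iio i).card) : u x = 0 := by
  have notMem_of_ne (z : X n k) (hz : u z ≠ 0) : i ∉ z.1 := fun hiz =>
    hi ((mem_suffixSpace.1 hu z hz i le_rfl).1 hiz)
  by_contra hne
  obtain ⟨m, hm⟩ := Nat.exists_eq_add_one.2 (show 0 < (x.1 ∩ Finset.Iio i).card by omega)
  have card_x := Finset.card_inter_add_card_sdiff x.1 (Finset.Iio i)
  rw [Set.powersetCard.card_eq] at card_x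
  let v (s : Finset (Fin n)) : ℂ := Function.extend Subtype.val u 0 (s ∪ x.1 \ Finset.Iio i)
  have sum_insert (s) (hs : s ∈ (Finset.Iio i).powersetCard m) :
      ∑ p ∈ Finset.Iio i \ s, v (insert p s) = 0 := by
    obtain ⟨hsi, hsm⟩ := Finset.mem_powersetCard.1 hs
    have hdisj : Disjoint s (x.1 \ Finset.Iio i) := Finset.disjoint_sdiff.mono_left hsi
    have sdiff_union : Finset.Iio i \ (s ∪ x.1 \ Finset.Iio i) = Finset.Iio i \ s := by grind
    simp only [v, Finset.insert_union, ← sdiff_union]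
    refine sum_extend_insert_eq_zero notMem_of_ne hc (fun his => ?_) ?_
    · rcases Finset.mem_union.1 his with h | h
      · exact Finset.notMem_Iio_self (hsi h)
      · exact notMem_of_ne x hne (Finset.mem_sdiff.1 h).1
    · rw [Finset.card_union_of_disjoint hdisj, hsm]
      omega
  have vanish : v (x.1 ∩ Finset.Iio i) = 0 :=
    eq_zero_of_sum_insert_eq_zero (by rw [Fin.card_Iio]; omega) sum_insert
      (Finset.mem_powersetCard.2 ⟨Finset.inter_subset_right, hm⟩)
  refine hne (Eq.trans ?_ vanish)
  simp only [v]
  rw [Finset.union_comm, Finset.sdiff_union_inter, Subtype.val_injective.extend_apply]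

theorem eq_zero_of_jucysMurphy_eq_smul {i : Fin n} {w : Set (Fin n)} {u₀ u₁ : F n k}
    (h₀ : u₀ ∈ suffixSpace n k i (w \ {i})) (h₁ : u₁ ∈ suffixSpace n k i (insert i w)) {c : ℂ}
    (hc₀ : jucysMurphy n k i u₀ = c • u₀) (hc₁ : jucysMurphy n k i u₁ = c • u₁) (hne : u₁ ≠ 0) :
    u₀ = 0 := by
  obtain ⟨y, hy⟩ : ∃ y, u₁ y ≠ 0 := not_forall.1 fun h => hne (PiLp.ext h)
  ext x
  by_contra! hx
  have hiy : i ∈ y.1 := (mem_suffixSpace.1 h₁ y hy i le_rfl).2 (Set.mem_insert i w)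
  have hix : i ∉ x.1 := fun hi => ((mem_suffixSpace.1 h₀ x hx i le_rfl).1 hi).2 rfl
  have card_x := card_inter_Iio_eq_succ hix hiy fun p hp => by
    rw [mem_suffixSpace.1 h₀ x hx p hp.le, mem_suffixSpace.1 h₁ y hy p hp.le]
    simp [hp.ne']
  have eigenvalues_eq := (jucysMurphy_eigenvalue_eq_card h₁ hc₁ hy).symm.trans
    (jucysMurphy_eigenvalue_eq_card h₀ hc₀ hx)
  simp only [hiy, hix, iff_true, iff_false, Nat.cast_inj] at eigenvalues_eq
  have card_Iio := Finset.card_filter_add_card_filter_not (s := Finset.Iio i) (· ∈ x.1)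
  rw [← eigenvalues_eq, Finset.filter_mem_eq_inter, Finset.filter_mem_eq_inter, Finset.inter_comm,
    Finset.inter_comm _ y.1, Fin.card_Iio] at card_Iio
  exact hx (apply_eq_zero_of_jucysMurphy_eq_smul (by simp) h₀ hc₀ (by omega))

/-- The joint eigenspace of the operators `swapSum n k j`, `j ≤ i`, for the eigenvalues `γ j`. It
contains the intersection of isotypic components that defines a Gelfand–Tsetlin space. -/
def jointEigenspace (n k i : ℕ) (γ : ℕ → ℂ) : Submodule ℂ (F n k) :=
  ⨅ j ≤ i, Module.End.eigenspace (swapSum n k j) (γ j)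

theorem mem_jointEigenspace {i : ℕ} {γ : ℕ → ℂ} {f : F n k} :
    f ∈ jointEigenspace n k i γ ↔ ∀ j ≤ i, swapSum n k j f = γ j • f := by
  simp only [jointEigenspace, Submodule.mem_iInf, Module.End.mem_eigenspace_iff]

theorem jointEigenspace_succ_le (i : ℕ) (γ : ℕ → ℂ) :
    jointEigenspace n k (i + 1) γ ≤ jointEigenspace n k i γ :=
  iInf_mono fun _ => le_iInf fun hj => iInf_le _ (Nat.le_succ_of_le hj)

theorem jucysMurphy_of_mem_jointEigenspace {i : Fin n} {γ : ℕ → ℂ} {f : F n k}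
    (hf : f ∈ jointEigenspace n k (i + 1) γ) :
    jucysMurphy n k i f = ((γ (i + 1) - γ i - 1) / 2) • f := by
  have eigen_succ := mem_jointEigenspace.1 hf (i + 1) le_rfl
  simp only [swapSum_succ, LinearMap.add_apply, LinearMap.smul_apply, Module.End.one_apply,
    mem_jointEigenspace.1 hf i (Nat.le_succ i)] at eigen_succ
  rw [div_eq_inv_mul, mul_smul, sub_smul, sub_smul, ← eigen_succ, one_smul,
    eq_inv_smul_iff₀ two_ne_zero]
  module

/-- The linear map that replaces the values of a function outside of `S` by `0`. -/
def cutoff (S : Set (X n k)) : Module.End ℂ (F n k) where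
  toFun f := WithLp.toLp 2 (S.indicator f)
  map_add' f g := congrArg (WithLp.toLp 2) (Set.indicator_add' S f g)
  map_smul' c f := congrArg (WithLp.toLp 2) (Set.indicator_const_smul S c f)

theorem cutoff_apply (S : Set (X n k)) (f : F n k) (x : X n k) :
    cutoff S f x = S.indicator f x := rfl

theorem commute_rep_cutoff {S : Set (X n k)} {σ : Perm (Fin n)} (h : ∀ x, σ⁻¹ • x ∈ S ↔ x ∈ S) :
    Commute (rep n k σ) (cutoff S) := by
  ext f x
  by_cases hx : x ∈ S <;> simp [rep_apply, cutoff_apply, h, hx]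

theorem cutoff_mem_jointEigenspace {S : Set (X n k)} {i : ℕ}
    (hS : ∀ p q : Fin n, p.1 < i → q.1 < i → ∀ x, swap p q • x ∈ S ↔ x ∈ S) {γ : ℕ → ℂ}
    {f : F n k} (hf : f ∈ jointEigenspace n k i γ) : cutoff S f ∈ jointEigenspace n k i γ := by
  refine mem_jointEigenspace.2 fun j hj => ?_
  have commute : Commute (swapSum n k j) (cutoff S) :=
    Commute.sum_left _ _ _ fun p hp => Commute.sum_left _ _ _ fun q hq =>
      commute_rep_cutoff fun x => by
        rw [swap_inv]
        exact hS p q ((Finset.mem_filter.1 hp).2.trans_le hj)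
          ((Finset.mem_filter.1 hq).2.trans_le hj) x
  rw [← Module.End.mul_apply, commute.eq, Module.End.mul_apply, mem_jointEigenspace.1 hf j hj,
    map_smul]

theorem jointEigenspace_inf_suffixSpace_succ_le (i : Fin n) (γ : ℕ → ℂ) (w : Set (Fin n)) :
    jointEigenspace n k i γ ⊓ suffixSpace n k (i + 1) w ≤
      (jointEigenspace n k i γ ⊓ suffixSpace n k i (insert i w)) ⊔
        (jointEigenspace n k i γ ⊓ suffixSpace n k i (w \ {i})) := by
  rintro f ⟨hf, hw⟩
  let S : Set (X n k) := {x | i ∈ x.1}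
  have hS (p q : Fin n) (hp : p.1 < i) (hq : q.1 < i) (x : X n k) : swap p q • x ∈ S ↔ x ∈ S := by
    simp only [S, Set.mem_ofPred_eq, mem_smul_iff, swap_inv]
    rw [swap_apply_of_ne_of_ne (Fin.ne_of_gt hp) (Fin.ne_of_gt hq)]
  have hcut := cutoff_mem_jointEigenspace hS hf
  have above {x : X n k} (hx : f x ≠ 0) {p : Fin n} (hp : i.1 ≤ p) (hpi : p ≠ i) :
      p ∈ x.1 ↔ p ∈ w :=
    mem_suffixSpace.1 hw x hx p (by have := Fin.val_ne_of_ne hpi; omega)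
  rw [← add_sub_cancel (cutoff S f) f]
  refine Submodule.add_mem_sup ⟨hcut, mem_suffixSpace.2 fun x hx p hp => ?_⟩
    ⟨sub_mem hf hcut, mem_suffixSpace.2 fun x hx p hp => ?_⟩
  · rw [cutoff_apply, Set.indicator_apply_ne_zero] at hx
    rcases eq_or_ne p i with rfl | hpi
    · exact iff_of_true hx.1 (Set.mem_insert p w)
    · simp [above hx.2 hp hpi, hpi]
  · have hxS : x ∉ S := fun h => hx (by simp [cutoff_apply, h])
    have hfx : f x ≠ 0 := by simpa [cutoff_apply, hxS] using hx
    rcases eq_or_ne p i with rfl | hpi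
    · exact iff_of_false hxS (by simp)
    · simp [above hfx hp hpi, hpi]

theorem finrank_le_one_of_le_sup {K V : Type*} [DivisionRing K] [AddCommGroup V] [Module K V]
    [FiniteDimensional K V] {U U₀ U₁ : Submodule K V} (hle : U ≤ U₁ ⊔ U₀)
    (h₁ : Module.finrank K U₁ ≤ 1) (h₀ : Module.finrank K U₀ ≤ 1)
    (h : U₁ ≤ U → U₀ ≤ U → U₁ = ⊥ ∨ U₀ = ⊥) : Module.finrank K U ≤ 1 := by
  by_contra! hlt
  have hsup := Submodule.finrank_add_le_finrank_add_finrank U₁ U₀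
  have hmono := Submodule.finrank_mono hle
  have heq : U = U₁ ⊔ U₀ := Submodule.eq_of_le_of_finrank_le hle (by omega)
  have hzero := h (heq ▸ le_sup_left) (heq ▸ le_sup_right)
  rw [← Submodule.finrank_eq_zero, ← Submodule.finrank_eq_zero] at hzero
  omega

theorem finrank_suffixSpace_zero_le_one (w : Set (Fin n)) :
    Module.finrank ℂ (suffixSpace n k 0 w) ≤ 1 := by
  have subsingleton : {x : X n k | ∀ p : Fin n, 0 ≤ p.1 → (p ∈ x.1 ↔ p ∈ w)}.Subsingleton := by
    intro x hx y hy
    ext p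
    exact (hx p (Nat.zero_le _)).trans (hy p (Nat.zero_le _)).symm
  rw [suffixSpace]
  rcases subsingleton.eq_empty_or_singleton with h | ⟨x, h⟩
  · rw [h, Set.image_empty, Submodule.span_empty, finrank_bot]
    exact zero_le_one
  · rw [h, Set.image_singleton]
    exact (finrank_span_le_card _).trans (by simp)

theorem finrank_jointEigenspace_inf_suffixSpace_le_one {i : ℕ} (hi : i ≤ n) (γ : ℕ → ℂ)
    (w : Set (Fin n)) :
    Module.finrank ℂ ↥(jointEigenspace n k i γ ⊓ suffixSpace n k i w) ≤ 1 := by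
  induction i generalizing w with
  | zero => exact (Submodule.finrank_mono inf_le_right).trans (finrank_suffixSpace_zero_le_one w)
  | succ i ih =>
    let p : Fin n := ⟨i, hi⟩
    refine finrank_le_one_of_le_sup
      ((inf_le_inf_right _ (jointEigenspace_succ_le i γ)).trans
        (jointEigenspace_inf_suffixSpace_succ_le p γ w)) (ih p.2.le _) (ih p.2.le _) ?_
    intro hle₁ hle₀
    refine or_iff_not_imp_left.2 fun hne => ?_
    obtain ⟨u₁, hu₁, hne₁⟩ := Submodule.exists_mem_ne_zero_of_ne_bot hne
    refine (Submodule.eq_bot_iff _).2 fun u₀ hu₀ => ?_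
    exact eq_zero_of_jucysMurphy_eq_smul hu₀.2 hu₁.2
      (jucysMurphy_of_mem_jointEigenspace (i := p) (hle₀ hu₀).1)
      (jucysMurphy_of_mem_jointEigenspace (i := p) (hle₁ hu₁).1) hne₁

theorem finrank_jointEigenspace_inf_suffixSpace_succ_le_two (i : Fin n) (γ : ℕ → ℂ)
    (w : Set (Fin n)) :
    Module.finrank ℂ ↥(jointEigenspace n k i γ ⊓ suffixSpace n k (i + 1) w) ≤ 2 :=
  calc _ ≤ _ := Submodule.finrank_mono (jointEigenspace_inf_suffixSpace_succ_le i γ w)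
    _ ≤ _ := Submodule.finrank_add_le_finrank_add_finrank _ _
    _ ≤ 1 + 1 := add_le_add (finrank_jointEigenspace_inf_suffixSpace_le_one i.2.le γ _)
      (finrank_jointEigenspace_inf_suffixSpace_le_one i.2.le γ _)

/-! ### Sparsity of the change of basis matrices -/

theorem card_le_finrank_of_forall_mem {K V ι : Type*} [DivisionRing K] [AddCommGroup V]
    [Module K V] [FiniteDimensional K V] {b : ι → V} (hb : LinearIndependent K b) {S : Finset ι}
    {U : Submodule K V} (hS : ∀ i ∈ S, b i ∈ U) : S.card ≤ Module.finrank K U := by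
  have : LinearIndependent K fun i : S => (⟨b i, hS i i.2⟩ : U) :=
    .of_comp U.subtype (hb.comp _ Subtype.val_injective)
  simpa using this.fintype_card_le_finrank

theorem eq_of_inner_ne_zero {𝕜 E : Type*} [RCLike 𝕜] [NormedAddCommGroup E] [InnerProductSpace 𝕜 E]
    {T : Module.End 𝕜 E} (hT : T.IsSymmetric) {c d : 𝕜} {f g : E} (hf : T f = c • f)
    (hg : T g = d • g) (h : inner 𝕜 f g ≠ 0) : c = d :=
  not_imp_comm.1 (hT.orthogonalFamily_eigenspaces · ⟨f, Module.End.mem_eigenspace_iff.2 hf⟩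
    ⟨g, Module.End.mem_eigenspace_iff.2 hg⟩) h

theorem mem_of_inner_ne_zero {i : ℕ} {f g : F n k} {γ γ' : ℕ → ℂ} {w w' : Set (Fin n)}
    (hf : f ∈ jointEigenspace n k i γ ⊓ suffixSpace n k i w)
    (hg : g ∈ jointEigenspace n k (i + 1) γ' ⊓ suffixSpace n k (i + 1) w')
    (h : inner ℂ f g ≠ 0) : f ∈ jointEigenspace n k i γ' ⊓ suffixSpace n k (i + 1) w' := by
  constructor
  · refine mem_jointEigenspace.2 fun j hj => ?_
    have hfj := mem_jointEigenspace.1 hf.1 j hj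
    rwa [eq_of_inner_ne_zero (isSymmetric_swapSum n k j) hfj
      (mem_jointEigenspace.1 hg.1 j (Nat.le_succ_of_le hj)) h] at hfj
  · rw [PiLp.inner_apply] at h
    obtain ⟨x, -, hx⟩ := Finset.exists_ne_zero_of_sum_ne_zero h
    have hfx : f x ≠ 0 := fun h0 => hx (by rw [h0, inner_zero_left])
    have hgx : g x ≠ 0 := fun h0 => hx (by rw [h0, inner_zero_right])
    exact suffixSpace_le_succ i (fun p hp => (mem_suffixSpace.1 hf.2 x hfx p (by omega)).symm.trans
      (mem_suffixSpace.1 hg.2 x hgx p hp)) hf.2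

theorem changeOfBasis_apply (b b' : OrthonormalBasis (X n k) ℂ (F n k)) (x y : X n k) :
    changeOfBasis b b' x y = inner ℂ (b' x) (b y) := by
  rw [changeOfBasis, Module.Basis.toMatrix_apply, OrthonormalBasis.coe_toBasis_repr_apply,
    OrthonormalBasis.repr_apply_apply]

namespace IsIntermediateBases

variable {B : ℕ → OrthonormalBasis (X n k) ℂ (F n k)}

theorem exists_mem_jointEigenspace (hB : IsIntermediateBases B) {i : ℕ} (h1 : 1 ≤ i) (hi : i ≤ n)
    (x : X n k) : ∃ γ w, B i x ∈ jointEigenspace n k i γ ⊓ suffixSpace n k i w := by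
  obtain ⟨l, w, -, hx⟩ := hB.gelfandTsetlin i h1 hi x
  refine ⟨fun j => if j = 0 then 0 else (swapEigenvalue (l j) : ℂ), w,
    mem_jointEigenspace.2 fun j hj => ?_, hx.2⟩
  rcases Nat.eq_zero_or_pos j with rfl | hj0
  · simp [swapSum]
  · have mem_isotypic := hx.1
    simp only [SetLike.mem_coe, Submodule.mem_iInf] at mem_isotypic
    rw [if_neg hj0.ne']
    exact Module.End.mem_eigenspace_iff.1 (isotypic_le_eigenspace _ _ (mem_isotypic j hj0 hj))

open Classical in
theorem card_changeOfBasis_row_ne_zero_le_two (hB : IsIntermediateBases B) {i : ℕ} (h1 : 1 ≤ i)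
    (hi : i < n) (x : X n k) :
    Finset.card {y | changeOfBasis (B i) (B (i + 1)) x y ≠ 0} ≤ 2 := by
  obtain ⟨γ', w', hx⟩ := hB.exists_mem_jointEigenspace (Nat.le_add_left 1 i) hi x
  refine (card_le_finrank_of_forall_mem (B i).orthonormal.linearIndependent fun y hy => ?_).trans
    (finrank_jointEigenspace_inf_suffixSpace_succ_le_two ⟨i, hi⟩ γ' w')
  obtain ⟨γ, w, hy'⟩ := hB.exists_mem_jointEigenspace h1 hi.le y
  rw [Finset.mem_filter_univ, changeOfBasis_apply] at hy
  exact mem_of_inner_ne_zero hy' hx (mt inner_eq_zero_symm.1 hy)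

theorem card_nonzeroEntries_changeOfBasis_le (hB : IsIntermediateBases B) {i : ℕ} (h1 : 1 ≤ i)
    (hi : i < n) :
    (Circuit.nonzeroEntries (changeOfBasis (B i) (B (i + 1)))).card ≤ 2 * n.choose k := by
  classical
  calc (Circuit.nonzeroEntries (changeOfBasis (B i) (B (i + 1)))).card
      = ∑ x, Finset.card {y | changeOfBasis (B i) (B (i + 1)) x y ≠ 0} := by
        simp only [Circuit.nonzeroEntries, Finset.card_filter, Fintype.sum_prod_type]
    _ ≤ ∑ x : X n k, 2 :=
        Finset.sum_le_sum fun x _ => hB.card_changeOfBasis_row_ne_zero_le_two h1 hi x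
    _ = 2 * n.choose k := by
        rw [Finset.sum_const, smul_eq_mul, mul_comm, Finset.card_univ, ← Nat.card_eq_fintype_card,
          Set.powersetCard.card, Nat.card_eq_fintype_card, Fintype.card_fin]

end IsIntermediateBases

theorem card_nonzeroEntries_changeOfBasis_comm (b b' : OrthonormalBasis (X n k) ℂ (F n k)) :
    (Circuit.nonzeroEntries (changeOfBasis b b')).card =
      (Circuit.nonzeroEntries (changeOfBasis b' b)).card := by
  refine Finset.card_nbij' Prod.swap Prod.swap ?_ ?_ (fun _ _ => rfl) (fun _ _ => rfl) <;>
  · intro e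
    simp [Circuit.nonzeroEntries, changeOfBasis_apply, inner_eq_zero_symm]

/-! ### The components of a function -/

theorem component_isOrtho {a b : Fin (min k (n - k) + 1)} (h : a ≠ b) :
    component n k a ⟂ component n k b :=
  isotypic_twoRow_isOrtho le_rfl (by omega) (Fin.val_ne_of_ne h)

theorem isotypic_le_component_or_isOrtho {μ : YoungDiagram} (hμ : μ.card = n)
    (a : Fin (min k (n - k) + 1)) :
    isotypic n k le_rfl μ ≤ component n k a ∨ isotypic n k le_rfl μ ⟂ component n k a := by
  by_cases three_rows : (2, 0) ∈ μ
  · exact .inl (by simp [isotypic_eq_bot_of_mem le_rfl three_rows])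
  obtain ⟨p, q, h, rfl⟩ := exists_eq_twoRow three_rows
  rw [card_twoRow] at hμ
  by_cases hq : q = a
  · obtain rfl : p = n - a := by omega
    subst hq
    exact .inl le_rfl
  · exact .inr (isotypic_twoRow_isOrtho le_rfl (by omega) hq)

namespace IsIntermediateBases

variable {B : ℕ → OrthonormalBasis (X n k) ℂ (F n k)}

theorem mem_component_or_mem_orthogonal (hB : IsIntermediateBases B) (hn : 1 ≤ n)
    (a : Fin (min k (n - k) + 1)) (x : X n k) :
    B n x ∈ component n k a ∨ B n x ∈ (component n k a)ᗮ := by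
  obtain ⟨l, w, hl, hx⟩ := hB.gelfandTsetlin n hn le_rfl x
  have mem_isotypic := hx.1
  simp only [SetLike.mem_coe, Submodule.mem_iInf] at mem_isotypic
  exact (isotypic_le_component_or_isOrtho (hl.1 n hn le_rfl) a).imp
    (· (mem_isotypic n hn le_rfl)) (· (mem_isotypic n hn le_rfl))

open Classical in
theorem repr_part (hB : IsIntermediateBases B) (hn : 1 ≤ n)
    (H : Finset (Fin (min k (n - k) + 1))) (f : F n k) (x : X n k) :
    (B n).repr (part H f) x =
      if ∃ a ∈ H, B n x ∈ component n k a then (B n).repr f x else 0 := by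
  simp only [OrthonormalBasis.repr_apply_apply, part, inner_sum,
    ← Submodule.inner_starProjection_left_eq_right]
  have projection_eq_zero (a) (ha : B n x ∉ component n k a) :
      (component n k a).starProjection (B n x) = 0 :=
    (Submodule.starProjection_apply_eq_zero_iff _).2
      ((hB.mem_component_or_mem_orthogonal hn a x).resolve_left ha)
  split_ifs with h
  · obtain ⟨a, ha, hax⟩ := h
    rw [Finset.sum_eq_single_of_mem a ha, Submodule.starProjection_eq_self_iff.2 hax]
    intro b _ hba
    rw [(Submodule.starProjection_apply_eq_zero_iff _).2 (component_isOrtho hba.symm hax),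
      inner_zero_left]
  · refine Finset.sum_eq_zero fun a ha => ?_
    rw [projection_eq_zero a fun hax => h ⟨a, ha, hax⟩, inner_zero_left]

end IsIntermediateBases

/-! ### The circuit -/

theorem zero_mem_knownConstants (B : ℕ → OrthonormalBasis (X n k) ℂ (F n k)) :
    0 ∈ knownConstants B :=
  .inl (.inl rfl)

namespace IsIntermediateBases

variable {B : ℕ → OrthonormalBasis (X n k) ℂ (F n k)} {σ : Type} {φ : (σ → ℂ) → F n k} {m : ℕ}

theorem computes_repr_last (hB : IsIntermediateBases B) (hn : 1 ≤ n)
    (h : Circuit.Computes (knownConstants B) m fun v => (B 1).repr (φ v)) :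
    Circuit.Computes (knownConstants B) (m + (n - 1) * (2 * n.choose k))
      fun v => (B n).repr (φ v) := by
  have chain := Circuit.Computes.basis_chain (fun i => B (i + 1)) h (zero_mem_knownConstants B)
    (l := n - 1) (fun i hi x y => .inr ⟨i + 2, by omega, by omega, x, y, .inl rfl⟩)
    fun i hi => hB.card_nonzeroEntries_changeOfBasis_le (by omega) (by omega)
  rwa [Nat.sub_add_cancel hn] at chain

theorem computes_repr_one (hB : IsIntermediateBases B) (hn : 1 ≤ n)
    (h : Circuit.Computes (knownConstants B) m fun v => (B n).repr (φ v)) :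
    Circuit.Computes (knownConstants B) (m + (n - 1) * (2 * n.choose k))
      fun v => (B 1).repr (φ v) := by
  have pred {i : ℕ} (hi : i < n - 1) : n - i = n - (i + 1) + 1 := by omega
  have chain := Circuit.Computes.basis_chain (fun i => B (n - i)) h (zero_mem_knownConstants B)
    (l := n - 1) (fun i hi x y => .inr ⟨n - i, by omega, by omega, x, y, .inr rfl⟩)
    fun i hi => by
      rw [pred hi]
      exact (card_nonzeroEntries_changeOfBasis_comm _ _).trans_le
        (hB.card_nonzeroEntries_changeOfBasis_le (by omega) (by omega))
  rwa [Nat.sub_sub_self hn] at chain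

end IsIntermediateBases

end Johnson

end

theorem mainTheorem3 (n k : ℕ) (hn : 1 ≤ n) (hk : k ≤ n)
    (B : ℕ → OrthonormalBasis (Johnson.X n k) ℂ (Johnson.F n k))
    (hB : Johnson.IsIntermediateBases B)
    (H : Finset (Fin (min k (n - k) + 1))) :
    ∃ P : Johnson.Circuit (Johnson.X n k) (Johnson.X n k),
      P.ConstantsIn (Johnson.knownConstants B) ∧
      P.cost ≤ 4 * (n - 1) * n.choose k ∧
      ∀ f : Johnson.F n k, P.eval ((B 0).repr f) = (B 0).repr (Johnson.part H f) := by
  classical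
  have hB₀ : B 1 = B 0 := hB.one.trans hB.zero.symm
  let function (v : Johnson.X n k → ℂ) : Johnson.F n k := (B 1).repr.symm (WithLp.toLp 2 v)
  have start : Johnson.Circuit.Computes (Johnson.knownConstants B) 0
      fun v => (B 1).repr (function v) := by
    simpa [function] using Johnson.Circuit.computes_id (Johnson.knownConstants B)
  have projected : Johnson.Circuit.Computes (Johnson.knownConstants B)
      (0 + (n - 1) * (2 * n.choose k)) fun v => (B n).repr (Johnson.part H (function v)) := by
    convert (hB.computes_repr_last hn start).ite_zero (Johnson.zero_mem_knownConstants B)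
      (fun x => ∃ a ∈ H, B n x ∈ Johnson.component n k a) using 3
    exact hB.repr_part hn H _ _
  obtain ⟨P, constants, cost, eval⟩ := (hB.computes_repr_one hn projected).exists_eval_eq
  refine ⟨P, constants, cost.trans (le_of_eq (by ring)), fun f => ?_⟩
  rw [← hB₀, eval]
  simp [function]
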